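/- For a complex Banach algebra $\mathcal A$ and an ultrafilter $\mathcal U$ on a set $I$, the ultrapower $(\mathcal A)_{\mathcal U}$ is the Banach algebra $\ell^\infty(\mathcal A, I)/\mathcal N_{\mathcal U}$ of bounded families $(a_i)_{i\in I}$ in $\mathcal A$ (with the supremum norm and the pointwise product) modulo the closed ideal $\mathcal N_{\mathcal U}$ of those families with $\lim_{i\to\mathcal U}\|a_i\|=0$. The ultrafilter $\mathcal U$ is \emph{countably incomplete} if there are sets $U_1\supseteq U_2\supseteq\cdots$ in $\mathcal U$ with $\bigcap_n U_n=\emptyset$. A Banach algebra $\mathcal A$ is \emph{amenable} if, for every Banach $\mathcal A$-bimodule $E$, every continuous derivation $d:\mathcal A\to E'$ into the dual bimodule is inner, that is, of the form $d(a)=a\cdot\mu-\mu\cdot a$ for some $\mu\in E'$. It is \emph{ultra-amenable} if $(\mathcal A)_{\mathcal U}$ is amenable for every non-principal ultrafilter $\mathcal U$ on every index set. \textbf{Theorem.} Let $G$ be an infinite discrete group, and let $\ell^1(G)$ be its convolution Banach algebra. If $\mathcal U$ is a countably incomplete ultrafilter on any set, then $(\ell^1(G))_{\mathcal U}$ is not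 amenable. In particular, $\ell^1(G)$ is not ultra-amenable. -/

import Mathlib

open scoped ENNReal Topology

universe u v w

noncomputable section

namespace BanachUltra

/-! ### Countably incomplete ultrafilters -/

/-- An ultrafilter is countably incomplete when it contains a decreasing sequence of sets
with empty intersection. -/
def CountablyIncomplete {I : Type v} (U : Ultrafilter I) : Prop :=
  ∃ s : ℕ → Set I, Antitone s ∧ (∀ n, s n ∈ U) ∧ ⋂ n, s n = ∅

/-- An ultrafilter is non-principal when it is not the ultrafilter of all sets
containing some given point. -/
def NonPrincipal {I : Type v} (U : Ultrafilter I) : Prop :=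
  ∀ i : I, U ≠ pure i

/-! ### Ultrapowers of Banach spaces and Banach algebras

`lp (fun _ : I => E) ∞` is the space of bounded families in `E` with the supremum norm. -/

section Space

variable {I : Type v} (U : Ultrafilter I) (E : Type u) [NormedAddCommGroup E] [NormedSpace ℂ E]

/-- The subspace of the bounded families whose norm tends to zero along the ultrafilter. -/
def nullFamilies : Submodule ℂ (lp (fun _ : I => E) ∞) where
  carrier := {x | Filter.Tendsto (fun i => ‖x i‖) U (𝓝 0)}
  zero_mem' := by simp
  add_mem' := by
    intro x y hx hy
    have h : Filter.Tendsto (fun i => ‖x i‖ + ‖y i‖) U (𝓝 0) := by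
      simpa using Filter.Tendsto.add hx hy
    exact squeeze_zero (fun i => norm_nonneg _) (fun i => norm_add_le (x i) (y i)) h
  smul_mem' := by
    intro c x hx
    have h : Filter.Tendsto (fun i => ‖c‖ * ‖x i‖) U (𝓝 0) := by
      simpa using Filter.Tendsto.const_mul ‖c‖ hx
    exact squeeze_zero (fun i => norm_nonneg _) (fun i => norm_smul_le c (x i)) h

variable {E} in
theorem mem_nullFamilies {x : lp (fun _ : I => E) ∞} :
    x ∈ nullFamilies U E ↔ Filter.Tendsto (fun i => ‖x i‖) U (𝓝 0) := Iff.rfl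

instance isClosed_nullFamilies :
    IsClosed ((nullFamilies U E : Submodule ℂ (lp (fun _ : I => E) ∞)) :
      Set (lp (fun _ : I => E) ∞)) := by
  refine isClosed_of_closure_subset fun x hx => ?_
  rw [Metric.mem_closure_iff] at hx
  change Filter.Tendsto (fun i => ‖x i‖) U (𝓝 0)
  rw [Metric.tendsto_nhds]
  intro ε hε
  obtain ⟨y, hy, hxy⟩ := hx (ε / 2) (half_pos hε)
  have hy' : Filter.Tendsto (fun i => ‖y i‖) U (𝓝 0) := hy
  rw [Metric.tendsto_nhds] at hy'
  filter_upwards [hy' (ε / 2) (half_pos hε)] with i hi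
  simp only [dist_zero_right, norm_norm] at hi ⊢
  have h1 : ‖x i - y i‖ ≤ ‖x - y‖ := lp.norm_apply_le_norm ENNReal.top_ne_zero (x - y) i
  rw [dist_eq_norm] at hxy
  have h2 : ‖x i‖ ≤ ‖x i - y i‖ + ‖y i‖ := by
    simpa using norm_add_le (x i - y i) (y i)
  linarith

/-- The ultrapower of a Banach space: the bounded families modulo the families which tend
to zero along the ultrafilter, with the quotient norm. -/
abbrev Ultrapower : Type (max u v) := lp (fun _ : I => E) ∞ ⧸ nullFamilies U E

end Space

section Algebra

variable {I : Type v} (U : Ultrafilter I) (A : Type u) [NonUnitalNormedRing A] [NormedSpace ℂ A]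

variable {A} in
theorem mul_mem_nullFamilies_right (x : lp (fun _ : I => A) ∞) {y : lp (fun _ : I => A) ∞}
    (hy : y ∈ nullFamilies U A) : x * y ∈ nullFamilies U A := by
  have h : Filter.Tendsto (fun i => ‖x‖ * ‖y i‖) U (𝓝 0) := by
    simpa using Filter.Tendsto.const_mul ‖x‖ ((mem_nullFamilies U).1 hy)
  exact squeeze_zero (fun i => norm_nonneg _)
    (fun i => (norm_mul_le (x i) (y i)).trans (mul_le_mul_of_nonneg_right
      (lp.norm_apply_le_norm ENNReal.top_ne_zero x i) (norm_nonneg _))) h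

variable {A} in
theorem mul_mem_nullFamilies_left {x : lp (fun _ : I => A) ∞} (hx : x ∈ nullFamilies U A)
    (y : lp (fun _ : I => A) ∞) : x * y ∈ nullFamilies U A := by
  have h : Filter.Tendsto (fun i => ‖x i‖ * ‖y‖) U (𝓝 0) := by
    simpa using Filter.Tendsto.mul_const ‖y‖ ((mem_nullFamilies U).1 hx)
  exact squeeze_zero (fun i => norm_nonneg _)
    (fun i => (norm_mul_le (x i) (y i)).trans (mul_le_mul_of_nonneg_left
      (lp.norm_apply_le_norm ENNReal.top_ne_zero y i) (norm_nonneg _))) h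

/-- The pointwise product of families, on equivalence classes. -/
instance : Mul (Ultrapower U A) where
  mul := Quotient.map₂ (fun x y => x * y) (by
    intro x x' hx y y' hy
    have hx' : x - x' ∈ nullFamilies U A := (Submodule.quotientRel_def _).1 hx
    have hy' : y - y' ∈ nullFamilies U A := (Submodule.quotientRel_def _).1 hy
    refine (Submodule.quotientRel_def _).2 ?_
    have h : x * y - x' * y' = (x - x') * y + x' * (y - y') := by
      rw [sub_mul, mul_sub]; abel
    change x * y - x' * y' ∈ _
    rw [h]
    exact add_mem (mul_mem_nullFamilies_left U hx' y) (mul_mem_nullFamilies_right U x' hy'))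

theorem mk_mul (x y : lp (fun _ : I => A) ∞) :
    (Submodule.Quotient.mk (x * y) : Ultrapower U A) =
      Submodule.Quotient.mk x * Submodule.Quotient.mk y := rfl

instance : NonUnitalNormedRing (Ultrapower U A) :=
  { (inferInstance : NormedAddCommGroup (Ultrapower U A)),
    (inferInstance : Mul (Ultrapower U A)) with
    left_distrib := by
      rintro ⟨x⟩ ⟨y⟩ ⟨z⟩
      exact congrArg Submodule.Quotient.mk (mul_add x y z)
    right_distrib := by
      rintro ⟨x⟩ ⟨y⟩ ⟨z⟩
      exact congrArg Submodule.Quotient.mk (add_mul x y z)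
    zero_mul := by
      rintro ⟨x⟩
      exact congrArg Submodule.Quotient.mk (zero_mul x)
    mul_zero := by
      rintro ⟨x⟩
      exact congrArg Submodule.Quotient.mk (mul_zero x)
    mul_assoc := by
      rintro ⟨x⟩ ⟨y⟩ ⟨z⟩
      exact congrArg Submodule.Quotient.mk (mul_assoc x y z)
    norm_mul_le := by
      intro a b
      have key : ∀ ε : ℝ, 0 < ε → ‖a * b‖ ≤ (‖a‖ + ε) * (‖b‖ + ε) := by
        intro ε hε
        obtain ⟨x, rfl, hx⟩ := Submodule.Quotient.norm_mk_lt a hε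
        obtain ⟨y, rfl, hy⟩ := Submodule.Quotient.norm_mk_lt b hε
        rw [← mk_mul]
        refine (Submodule.Quotient.norm_mk_le _ _).trans ((norm_mul_le x y).trans ?_)
        exact mul_le_mul hx.le hy.le (norm_nonneg _) (by positivity)
      have hlim : Filter.Tendsto (fun ε : ℝ => (‖a‖ + ε) * (‖b‖ + ε)) (𝓝[>] 0)
          (𝓝 (‖a‖ * ‖b‖)) := by
        have hc : Continuous (fun ε : ℝ => (‖a‖ + ε) * (‖b‖ + ε)) := by fun_prop
        simpa using (hc.tendsto 0).mono_left nhdsWithin_le_nhds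
      exact ge_of_tendsto hlim (by filter_upwards [self_mem_nhdsWithin] with ε hε using key ε hε) }

instance [IsScalarTower ℂ A A] : IsScalarTower ℂ (Ultrapower U A) (Ultrapower U A) where
  smul_assoc := by
    rintro c ⟨x⟩ ⟨y⟩
    exact congrArg Submodule.Quotient.mk (smul_assoc c x y)

instance [SMulCommClass ℂ A A] : SMulCommClass ℂ (Ultrapower U A) (Ultrapower U A) where
  smul_comm := by
    rintro c ⟨x⟩ ⟨y⟩
    exact congrArg Submodule.Quotient.mk (smul_comm c x y)

end Algebra

/-! ### The convolution algebra `ℓ¹(G)` of a discrete group -/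

section GroupAlgebra

variable (G : Type u)

/-- The Banach space `ℓ¹(G)` of absolutely summable complex functions on `G`. -/
abbrev L1 : Type u := lp (fun _ : G => ℂ) 1

variable {G}

theorem L1.summable_norm (a : L1 G) : Summable fun g => ‖a g‖ := by
  simpa using (lp.memℓp a).summable (p := 1) (by simp)

theorem L1.norm_eq (a : L1 G) : ‖a‖ = ∑' g, ‖a g‖ := by
  simpa using lp.norm_eq_tsum_rpow (p := 1) (by simp) a

variable [Group G]

/-- The bijection `(h, k) ↦ (h, h * k)` of `G × G`. -/
def shear : G × G ≃ G × G where
  toFun p := (p.1, p.1 * p.2)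
  invFun p := (p.1, p.1⁻¹ * p.2)
  left_inv p := by simp
  right_inv p := by simp

theorem L1.summable_prod (a b : L1 G) :
    Summable fun p : G × G => ‖a p.1 * b (p.1⁻¹ * p.2)‖ := by
  have h := a.summable_norm.mul_of_nonneg b.summable_norm (fun _ => norm_nonneg _)
    (fun _ => norm_nonneg _)
  rw [← (shear (G := G)).symm.summable_iff] at h
  refine h.congr fun p => ?_
  simp [shear]

theorem L1.summable_fiber (a b : L1 G) (g : G) :
    Summable fun h => ‖a h * b (h⁻¹ * g)‖ :=
  ((L1.summable_prod a b).prod_symm).prod_factor g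

theorem L1.summable_conv (a b : L1 G) : Summable fun g => ‖∑' h, a h * b (h⁻¹ * g)‖ := by
  have h := ((L1.summable_prod a b).prod_symm).prod
  exact Summable.of_nonneg_of_le (fun _ => norm_nonneg _)
    (fun g => norm_tsum_le_tsum_norm (L1.summable_fiber a b g)) h

/-- Convolution: `(a * b)(g) = ∑ h, a(h) b(h⁻¹ g)`, so that `δ_g * δ_h = δ_{gh}`. -/
instance : Mul (L1 G) where
  mul a b := ⟨fun g => ∑' h, a h * b (h⁻¹ * g), memℓp_gen (by
    simpa using L1.summable_conv a b)⟩

theorem L1.mul_apply (a b : L1 G) (g : G) : (a * b) g = ∑' h, a h * b (h⁻¹ * g) := rfl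

theorem L1.norm_mul_le' (a b : L1 G) : ‖a * b‖ ≤ ‖a‖ * ‖b‖ := by
  have hp := L1.summable_prod a b
  calc ‖a * b‖ = ∑' g, ‖∑' h, a h * b (h⁻¹ * g)‖ := L1.norm_eq _
    _ ≤ ∑' g, ∑' h, ‖a h * b (h⁻¹ * g)‖ :=
        (L1.summable_conv a b).tsum_le_tsum
          (fun g => norm_tsum_le_tsum_norm (L1.summable_fiber a b g)) hp.prod_symm.prod
    _ = ∑' h, ∑' g, ‖a h * b (h⁻¹ * g)‖ := hp.tsum_comm
    _ = ∑' h, ‖a h‖ * ‖b‖ := by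
        refine tsum_congr fun h => ?_
        rw [L1.norm_eq b, ← (Equiv.mulLeft h⁻¹).tsum_eq (fun g => ‖b g‖), ← tsum_mul_left]
        simp
    _ = ‖a‖ * ‖b‖ := by rw [tsum_mul_right, ← L1.norm_eq]

theorem L1.mul_assoc' (a b c : L1 G) : a * b * c = a * (b * c) := by
  ext g
  have hsum : Summable fun p : G × G => a p.1 * b (p.1⁻¹ * p.2) * c (p.2⁻¹ * g) := by
    refine Summable.of_norm_bounded ((L1.summable_prod a b).mul_right ‖c‖) fun p => ?_
    rw [norm_mul]
    exact mul_le_mul_of_nonneg_left (lp.norm_apply_le_norm (by simp) c _) (norm_nonneg _)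
  calc (a * b * c) g = ∑' h, (∑' k, a k * b (k⁻¹ * h)) * c (h⁻¹ * g) := rfl
    _ = ∑' h, ∑' k, a k * b (k⁻¹ * h) * c (h⁻¹ * g) := by simp only [tsum_mul_right]
    _ = ∑' k, ∑' h, a k * b (k⁻¹ * h) * c (h⁻¹ * g) := hsum.tsum_comm
    _ = ∑' k, a k * ∑' h, b h * c (h⁻¹ * (k⁻¹ * g)) := by
        refine tsum_congr fun k => ?_
        rw [← tsum_mul_left,
          ← (Equiv.mulLeft k⁻¹).tsum_eq (fun h => a k * (b h * c (h⁻¹ * (k⁻¹ * g))))]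
        refine tsum_congr fun h => ?_
        simp [mul_assoc]
    _ = (a * (b * c)) g := rfl

instance : NonUnitalNormedRing (L1 G) :=
  { (inferInstance : NormedAddCommGroup (L1 G)), (inferInstance : Mul (L1 G)) with
    left_distrib := by
      intro a b c
      ext g
      change ∑' h, a h * (b (h⁻¹ * g) + c (h⁻¹ * g)) = _ + _
      simp only [mul_add]
      exact (L1.summable_fiber a b g).of_norm.tsum_add (L1.summable_fiber a c g).of_norm
    right_distrib := by
      intro a b c
      ext g
      change ∑' h, (a h + b h) * c (h⁻¹ * g) = _ + _
      simp only [add_mul]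
      exact (L1.summable_fiber a c g).of_norm.tsum_add (L1.summable_fiber b c g).of_norm
    zero_mul := by
      intro a
      ext g
      simp [L1.mul_apply]
    mul_zero := by
      intro a
      ext g
      simp [L1.mul_apply]
    mul_assoc := L1.mul_assoc'
    norm_mul_le := L1.norm_mul_le' }

instance : IsScalarTower ℂ (L1 G) (L1 G) where
  smul_assoc c a b := by
    ext g
    simp [L1.mul_apply, mul_assoc, tsum_mul_left]

instance : SMulCommClass ℂ (L1 G) (L1 G) where
  smul_comm c a b := by
    ext g
    simp [L1.mul_apply, mul_left_comm, tsum_mul_left]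

end GroupAlgebra

/-! ### Amenability -/

section Amenable

variable (A : Type u) [NonUnitalNormedRing A] [NormedSpace ℂ A]

/-- A Banach bimodule structure over the Banach algebra `A` on the Banach space `E`: bounded
bilinear left and right actions which are associative and commute with each other.
Here `lact a x` is `a · x` and `ract a x` is `x · a`. -/
structure BanachBimodule (E : Type w) [NormedAddCommGroup E] [NormedSpace ℂ E] where
  lact : A →L[ℂ] E →L[ℂ] E
  ract : A →L[ℂ] E →L[ℂ] E
  mul_lact : ∀ a b x, lact (a * b) x = lact a (lact b x)
  ract_mul : ∀ a b x, ract (a * b) x = ract b (ract a x)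
  lact_ract : ∀ a b x, ract b (lact a x) = lact a (ract b x)

variable {A}

/-- The dual bimodule: `⟨a · μ, x⟩ = ⟨μ, x · a⟩` and `⟨μ · a, x⟩ = ⟨μ, a · x⟩`. -/
def BanachBimodule.dual {E : Type w} [NormedAddCommGroup E] [NormedSpace ℂ E]
    (M : BanachBimodule A E) : BanachBimodule A (StrongDual ℂ E) where
  lact := (ContinuousLinearMap.compL ℂ E E ℂ).flip.comp M.ract
  ract := (ContinuousLinearMap.compL ℂ E E ℂ).flip.comp M.lact
  mul_lact a b μ := by ext x; simp [M.ract_mul]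
  ract_mul a b μ := by ext x; simp [M.mul_lact]
  lact_ract a b μ := by ext x; simp [M.lact_ract]

/-- A continuous derivation `d(ab) = a · d(b) + d(a) · b` into a Banach bimodule. -/
def BanachBimodule.IsDerivation {E : Type w} [NormedAddCommGroup E] [NormedSpace ℂ E]
    (M : BanachBimodule A E) (d : A →L[ℂ] E) : Prop :=
  ∀ a b, d (a * b) = M.lact a (d b) + M.ract b (d a)

/-- An inner derivation `a ↦ a · x - x · a`. -/
def BanachBimodule.IsInner {E : Type w} [NormedAddCommGroup E] [NormedSpace ℂ E]
    (M : BanachBimodule A E) (d : A →L[ℂ] E) : Prop :=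
  ∃ x : E, ∀ a, d a = M.lact a x - M.ract a x

variable (A)

/-- A Banach algebra is amenable if every continuous derivation into the dual of a Banach
bimodule is inner. The bimodules live in the universe of the algebra, which is large enough for
`A`, its projective tensor square, and all duals and quotients of these. -/
def Amenable [CompleteSpace A] [IsScalarTower ℂ A A] [SMulCommClass ℂ A A] : Prop :=
  ∀ (E : Type u) [NormedAddCommGroup E] [NormedSpace ℂ E] [CompleteSpace E]
    (M : BanachBimodule A E) (d : A →L[ℂ] StrongDual ℂ E),
    M.dual.IsDerivation d → M.dual.IsInner d

/-- A Banach algebra is ultra-amenable if its ultrapower along every non-principal ultrafilter,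
on an index set in the universe `v`, is amenable. -/
def UltraAmenable [CompleteSpace A] [IsScalarTower ℂ A A] [SMulCommClass ℂ A A] : Prop :=
  ∀ (I : Type v) (U : Ultrafilter I), NonPrincipal U → Amenable (Ultrapower U A)

end Amenable

end BanachUltra

end

noncomputable section

namespace BanachUltra

/-! ### A left ideal obstruction to amenability -/

section Obstruction

variable {B : Type u} [NonUnitalNormedRing B] [NormedSpace ℂ B]

/-- The bounded operators of `B` which vanish on `J` and take values in `J`. -/
def operatorsThrough (J : Submodule ℂ B) : Submodule ℂ (B →L[ℂ] B) where
  carrier := {T | (∀ x ∈ J, T x = 0) ∧ ∀ x, T x ∈ J}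
  zero_mem' := by simp
  add_mem' := by
    intro S T hS hT
    exact ⟨fun x hx => by simp [hS.1 x hx, hT.1 x hx], fun x => J.add_mem (hS.2 x) (hT.2 x)⟩
  smul_mem' := by
    intro c T hT
    exact ⟨fun x hx => by simp [hT.1 x hx], fun x => J.smul_mem c (hT.2 x)⟩

/-- The normed space of the bounded operators which vanish on `J` and take values in `J`. -/
def OperatorsThrough (J : Submodule ℂ B) : Type u := operatorsThrough J

instance (J : Submodule ℂ B) : NormedAddCommGroup (OperatorsThrough J) :=
  inferInstanceAs (NormedAddCommGroup (operatorsThrough J))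

instance (J : Submodule ℂ B) : NormedSpace ℂ (OperatorsThrough J) :=
  inferInstanceAs (NormedSpace ℂ (operatorsThrough J))

/-- The operator underlying an element of `OperatorsThrough J`. -/
def OperatorsThrough.toOperator (J : Submodule ℂ B) : OperatorsThrough J →L[ℂ] B →L[ℂ] B :=
  (operatorsThrough J).subtypeL

theorem OperatorsThrough.ext {J : Submodule ℂ B} {S T : OperatorsThrough J}
    (h : ∀ x, toOperator J S x = toOperator J T x) : S = T :=
  Subtype.ext (ContinuousLinearMap.ext h)

/-- The functional `T ↦ ψ (T x)`. -/
def evalFunctional (J : Submodule ℂ B) (x : B) (ψ : StrongDual ℂ B) :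
    StrongDual ℂ (OperatorsThrough J) :=
  ψ.comp ((ContinuousLinearMap.apply ℂ B x).comp (OperatorsThrough.toOperator J))

variable [IsScalarTower ℂ B B] [SMulCommClass ℂ B B]

/-- The left action `(a · T)(x) = a T(x)`. -/
def operatorsLeft (J : Submodule ℂ B) (hJ : ∀ a, ∀ x ∈ J, a * x ∈ J) :
    B →L[ℂ] OperatorsThrough J →L[ℂ] OperatorsThrough J :=
  LinearMap.mkContinuous₂ (LinearMap.mk₂ ℂ
    (fun (a : B) (T : OperatorsThrough J) => (⟨(ContinuousLinearMap.mul ℂ B a).comp T.1,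
      fun x hx => by simp [T.2.1 x hx], fun x => hJ a _ (T.2.2 x)⟩ : OperatorsThrough J))
    (fun a b T => OperatorsThrough.ext fun x => add_mul a b (T.1 x))
    (fun c a T => OperatorsThrough.ext fun x => smul_mul_assoc c a (T.1 x))
    (fun a S T => OperatorsThrough.ext fun x => mul_add a (S.1 x) (T.1 x))
    (fun c a T => OperatorsThrough.ext fun x => mul_smul_comm c a (T.1 x))) 1 (fun a T => by
      rw [one_mul]
      change ‖(ContinuousLinearMap.mul ℂ B a).comp T.1‖ ≤ ‖a‖ * ‖T.1‖
      refine (ContinuousLinearMap.opNorm_comp_le _ _).trans ?_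
      gcongr
      exact ContinuousLinearMap.opNorm_mul_apply_le ℂ B a)

/-- The right action `(T · a)(x) = T(a x)`. -/
def operatorsRight (J : Submodule ℂ B) (hJ : ∀ a, ∀ x ∈ J, a * x ∈ J) :
    B →L[ℂ] OperatorsThrough J →L[ℂ] OperatorsThrough J :=
  LinearMap.mkContinuous₂ (LinearMap.mk₂ ℂ
    (fun (a : B) (T : OperatorsThrough J) => (⟨T.1.comp (ContinuousLinearMap.mul ℂ B a),
      fun x hx => T.2.1 _ (hJ a x hx), fun x => T.2.2 _⟩ : OperatorsThrough J))
    (fun a b T => OperatorsThrough.ext fun x => 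
      (congrArg T.1 (add_mul a b x)).trans (map_add T.1 _ _))
    (fun c a T => OperatorsThrough.ext fun x =>
      (congrArg T.1 (smul_mul_assoc c a x)).trans (map_smul T.1 _ _))
    (fun _ _ _ => rfl)
    (fun _ _ _ => rfl)) 1 (fun a T => by
      rw [one_mul, mul_comm]
      change ‖T.1.comp (ContinuousLinearMap.mul ℂ B a)‖ ≤ ‖T.1‖ * ‖a‖
      refine (ContinuousLinearMap.opNorm_comp_le _ _).trans ?_
      gcongr
      exact ContinuousLinearMap.opNorm_mul_apply_le ℂ B a)

/-- The bimodule structure `(a · T)(x) = a T(x)`, `(T · a)(x) = T(a x)` on the operators which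
vanish on a left ideal and take values in it. -/
def operatorsBimodule (J : Submodule ℂ B) (hJ : ∀ a, ∀ x ∈ J, a * x ∈ J) :
    BanachBimodule B (OperatorsThrough J) where
  lact := operatorsLeft J hJ
  ract := operatorsRight J hJ
  mul_lact a b T := OperatorsThrough.ext fun x => mul_assoc a b (T.1 x)
  ract_mul a b T := OperatorsThrough.ext fun x =>
    congrArg T.1 (mul_assoc a b x)
  lact_ract _ _ _ := rfl

/-- The derivation `a ↦ a · P - P · a` for a bounded projection `P` onto the left ideal `J`. -/
def projectionDerivation (J : Submodule ℂ B) (hJ : ∀ a, ∀ x ∈ J, a * x ∈ J) (P : B →L[ℂ] B)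
    (hP : ∀ x, P x ∈ J) (hPJ : ∀ x ∈ J, P x = x) : B →L[ℂ] OperatorsThrough J :=
  LinearMap.mkContinuous
    { toFun := fun a => ⟨(ContinuousLinearMap.mul ℂ B a).comp P -
          P.comp (ContinuousLinearMap.mul ℂ B a),
        fun x hx => by simp [hPJ x hx, hPJ _ (hJ a x hx)],
        fun x => J.sub_mem (hJ a _ (hP x)) (hP _)⟩
      map_add' := fun a b => OperatorsThrough.ext fun x => by
        change (a + b) * P x - P ((a + b) * x) = (a * P x - P (a * x)) + (b * P x - P (b * x))
        rw [add_mul, add_mul, map_add]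
        abel
      map_smul' := fun c a => OperatorsThrough.ext fun x => by
        change (c • a) * P x - P ((c • a) * x) = c • (a * P x - P (a * x))
        rw [smul_mul_assoc, smul_mul_assoc, map_smul, smul_sub] } (2 * ‖P‖) (fun a => by
        have h1 : ‖(ContinuousLinearMap.mul ℂ B a).comp P‖ ≤ ‖a‖ * ‖P‖ :=
          (ContinuousLinearMap.opNorm_comp_le _ _).trans
            (by gcongr; exact ContinuousLinearMap.opNorm_mul_apply_le ℂ B a)
        have h2 : ‖P.comp (ContinuousLinearMap.mul ℂ B a)‖ ≤ ‖P‖ * ‖a‖ :=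
          (ContinuousLinearMap.opNorm_comp_le _ _).trans
            (by gcongr; exact ContinuousLinearMap.opNorm_mul_apply_le ℂ B a)
        refine (norm_sub_le ((ContinuousLinearMap.mul ℂ B a).comp P)
          (P.comp (ContinuousLinearMap.mul ℂ B a))).trans ?_
        linarith)

theorem projectionDerivation_apply (J : Submodule ℂ B) (hJ : ∀ a, ∀ x ∈ J, a * x ∈ J)
    (P : B →L[ℂ] B) (hP : ∀ x, P x ∈ J) (hPJ : ∀ x ∈ J, P x = x) (a x : B) :
    (projectionDerivation J hJ P hP hPJ a).1 x = a * P x - P (a * x) := rfl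

/-- In an amenable Banach algebra with a right identity, a continuous functional which vanishes
on the products of elements of a complemented left ideal vanishes on the ideal. -/
theorem Amenable.eq_zero_of_mul_eq_zero [CompleteSpace B] (hB : Amenable B) (e : B)
    (he : ∀ x, x * e = x) (J : Submodule ℂ B) (hJ : ∀ a, ∀ x ∈ J, a * x ∈ J) (P : B →L[ℂ] B)
    (hP : ∀ x, P x ∈ J) (hPJ : ∀ x ∈ J, P x = x) (ψ : StrongDual ℂ B)
    (hψ : ∀ x ∈ J, ∀ y ∈ J, ψ (x * y) = 0) : ∀ x ∈ J, ψ x = 0 := by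
  intro j hj
  set M := operatorsBimodule J hJ with hM
  set d := projectionDerivation J hJ P hP hPJ with hd
  have hder : ∀ a b, d (a * b) = M.lact a (d b) + M.ract b (d a) := by
    intro a b
    refine OperatorsThrough.ext fun x => ?_
    change a * b * P x - P (a * b * x) =
      a * (b * P x - P (b * x)) + (a * P (b * x) - P (a * (b * x)))
    rw [mul_sub, mul_assoc, mul_assoc]
    abel
  obtain ⟨μ, hμ⟩ := hB (StrongDual ℂ (OperatorsThrough J)) M.dual
    ((NormedSpace.inclusionInDoubleDual ℂ (OperatorsThrough J)).comp d) (by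
      intro a b
      ext f
      change f (d (a * b)) = f (M.lact a (d b)) + f (M.ract b (d a))
      rw [hder, map_add])
  have h := congrArg (fun F => F (evalFunctional J e ψ)) (hμ j)
  change ψ ((d j).1 e) = μ (M.dual.ract j (evalFunctional J e ψ)) -
    μ (M.dual.lact j (evalFunctional J e ψ)) at h
  have h1 : M.dual.ract j (evalFunctional J e ψ) = 0 := by
    ext T
    change ψ (j * T.1 e) = 0
    exact hψ j hj _ (T.2.2 e)
  have h2 : M.dual.lact j (evalFunctional J e ψ) = 0 := by
    ext T
    change ψ (T.1 (j * e)) = 0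
    rw [he, T.2.1 j hj, map_zero]
  rw [h1, h2, hd, projectionDerivation_apply, he, hPJ j hj, map_sub, hψ j hj _ (hP e)] at h
  simpa using h

end Obstruction

/-! ### Functionals on ultrapowers -/

section UltraFunctional

variable {I : Type v} (U : Ultrafilter I) {E : Type u} [NormedAddCommGroup E] [NormedSpace ℂ E]

theorem exists_tendsto_of_norm_le (f : I → ℂ) (C : ℝ) (hf : ∀ i, ‖f i‖ ≤ C) :
    ∃ z, Filter.Tendsto f U (𝓝 z) := by
  obtain ⟨z, -, hz⟩ := (isCompact_closedBall (0 : ℂ) C).ultrafilter_le_nhds (U.map f)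
    (Filter.tendsto_principal.2 (Filter.Eventually.of_forall fun i => by simpa using hf i))
  exact ⟨z, hz⟩

theorem norm_apply_le_of_bound (ℓ : I → StrongDual ℂ E) (hℓ : ∀ i y, ‖ℓ i y‖ ≤ ‖y‖)
    (x : lp (fun _ : I => E) ∞) (i : I) : ‖ℓ i (x i)‖ ≤ ‖x‖ :=
  (hℓ i _).trans (lp.norm_apply_le_norm ENNReal.top_ne_zero x i)

/-- The functional `(x_i) ↦ lim ℓ_i(x_i)` on bounded families, for contractive `ℓ_i`. -/
def familyFunctional (ℓ : I → StrongDual ℂ E) (hℓ : ∀ i y, ‖ℓ i y‖ ≤ ‖y‖) :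
    StrongDual ℂ (lp (fun _ : I => E) ∞) :=
  LinearMap.mkContinuous
    { toFun := fun x => (exists_tendsto_of_norm_le U (fun i => ℓ i (x i)) ‖x‖
        (norm_apply_le_of_bound ℓ hℓ x)).choose
      map_add' := fun x y => by
        refine tendsto_nhds_unique (exists_tendsto_of_norm_le U (fun i => ℓ i ((x + y) i)) ‖x + y‖
          (norm_apply_le_of_bound ℓ hℓ (x + y))).choose_spec ?_
        refine (((exists_tendsto_of_norm_le U (fun i => ℓ i (x i)) ‖x‖
          (norm_apply_le_of_bound ℓ hℓ x)).choose_spec).add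
          ((exists_tendsto_of_norm_le U (fun i => ℓ i (y i)) ‖y‖
          (norm_apply_le_of_bound ℓ hℓ y)).choose_spec)).congr fun i => ?_
        simp
      map_smul' := fun c x => by
        refine tendsto_nhds_unique (exists_tendsto_of_norm_le U (fun i => ℓ i ((c • x) i)) ‖c • x‖
          (norm_apply_le_of_bound ℓ hℓ (c • x))).choose_spec ?_
        refine (((exists_tendsto_of_norm_le U (fun i => ℓ i (x i)) ‖x‖
          (norm_apply_le_of_bound ℓ hℓ x)).choose_spec).const_mul c).congr fun i => ?_
        simp } 1 (fun x => by
      rw [one_mul]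
      exact le_of_tendsto (exists_tendsto_of_norm_le U (fun i => ℓ i (x i)) ‖x‖
        (norm_apply_le_of_bound ℓ hℓ x)).choose_spec.norm
        (Filter.Eventually.of_forall (norm_apply_le_of_bound ℓ hℓ x)))

theorem tendsto_familyFunctional (ℓ : I → StrongDual ℂ E) (hℓ : ∀ i y, ‖ℓ i y‖ ≤ ‖y‖)
    (x : lp (fun _ : I => E) ∞) :
    Filter.Tendsto (fun i => ℓ i (x i)) U (𝓝 (familyFunctional U ℓ hℓ x)) :=
  (exists_tendsto_of_norm_le U (fun i => ℓ i (x i)) ‖x‖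
    (norm_apply_le_of_bound ℓ hℓ x)).choose_spec

/-- The functional `[x_i] ↦ lim ℓ_i(x_i)` on an ultrapower, for contractive `ℓ_i`. -/
def ultraFunctional (ℓ : I → StrongDual ℂ E) (hℓ : ∀ i y, ‖ℓ i y‖ ≤ ‖y‖) :
    StrongDual ℂ (Ultrapower U E) :=
  (nullFamilies U E).liftQL (familyFunctional U ℓ hℓ) fun x hx =>
    tendsto_nhds_unique (tendsto_familyFunctional U ℓ hℓ x)
      (squeeze_zero_norm (fun i => hℓ i (x i)) ((mem_nullFamilies U).1 hx))

theorem tendsto_ultraFunctional (ℓ : I → StrongDual ℂ E) (hℓ : ∀ i y, ‖ℓ i y‖ ≤ ‖y‖)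
    (x : lp (fun _ : I => E) ∞) :
    Filter.Tendsto (fun i => ℓ i (x i)) U
      (𝓝 (ultraFunctional U ℓ hℓ (Submodule.Quotient.mk x))) :=
  tendsto_familyFunctional U ℓ hℓ x

end UltraFunctional

/-! ### Functionals and convolution on `ℓ¹(G)` -/

section Pairing

variable {G : Type u}

theorem L1.enorm_eq (a : L1 G) : ‖a‖ₑ = ∑' g, ‖a g‖ₑ := by
  rw [← ofReal_norm, L1.norm_eq, ENNReal.ofReal_tsum_of_nonneg (fun _ => norm_nonneg _)
    a.summable_norm]
  simp only [ofReal_norm]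

theorem L1.norm_weighted_le (w : G → ℂ) (hw : ∀ g, ‖w g‖ ≤ 1) (a : L1 G) (g : G) :
    ‖w g * a g‖ ≤ ‖a g‖ := by
  rw [norm_mul]
  exact mul_le_of_le_one_left (norm_nonneg _) (hw g)

theorem L1.summable_weighted (w : G → ℂ) (hw : ∀ g, ‖w g‖ ≤ 1) (a : L1 G) :
    Summable fun g => ‖w g * a g‖ :=
  Summable.of_nonneg_of_le (fun _ => norm_nonneg _) (L1.norm_weighted_le w hw a) a.summable_norm

/-- The pairing of `ℓ¹(G)` with a function bounded by one. -/
def L1.pairing (w : G → ℂ) (hw : ∀ g, ‖w g‖ ≤ 1) : StrongDual ℂ (L1 G) :=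
  LinearMap.mkContinuous
    { toFun := fun a => ∑' g, w g * a g
      map_add' := fun a b => by
        rw [← (L1.summable_weighted w hw a).of_norm.tsum_add (L1.summable_weighted w hw b).of_norm]
        exact tsum_congr fun g => mul_add _ _ _
      map_smul' := fun c a => by
        rw [smul_eq_mul, ← tsum_mul_left]
        exact tsum_congr fun g => mul_left_comm _ _ _ } 1 (fun a => by
      rw [one_mul, L1.norm_eq]
      exact (norm_tsum_le_tsum_norm (L1.summable_weighted w hw a)).trans
        ((L1.summable_weighted w hw a).tsum_le_tsum (L1.norm_weighted_le w hw a)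
          a.summable_norm))

theorem L1.pairing_apply (w : G → ℂ) (hw : ∀ g, ‖w g‖ ≤ 1) (a : L1 G) :
    L1.pairing w hw a = ∑' g, w g * a g := rfl

theorem L1.norm_pairing_le (w : G → ℂ) (hw : ∀ g, ‖w g‖ ≤ 1) (a : L1 G) :
    ‖L1.pairing w hw a‖ ≤ ‖a‖ := by
  rw [L1.pairing_apply, L1.norm_eq]
  exact (norm_tsum_le_tsum_norm (L1.summable_weighted w hw a)).trans
    ((L1.summable_weighted w hw a).tsum_le_tsum (L1.norm_weighted_le w hw a) a.summable_norm)

theorem norm_indicator_one_le (E : Set G) (g : G) : ‖E.indicator (1 : G → ℂ) g‖ ≤ 1 := by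
  by_cases hg : g ∈ E <;> simp [hg]

/-- Evaluation at a point. -/
def L1.eval (g : G) : StrongDual ℂ (L1 G) :=
  LinearMap.mkContinuous
    { toFun := fun a => a g
      map_add' := fun _ _ => rfl
      map_smul' := fun _ _ => rfl } 1 (fun a => by
      rw [one_mul]
      exact lp.norm_apply_le_norm (by simp) a g)

theorem L1.norm_eval_le (g : G) (a : L1 G) : ‖L1.eval g a‖ ≤ ‖a‖ :=
  lp.norm_apply_le_norm (by simp) a g

variable [Group G]

theorem L1.mul_single_one [DecidableEq G] (a : L1 G) : a * lp.single 1 (1 : G) (1 : ℂ) = a := by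
  ext g
  rw [L1.mul_apply, tsum_eq_single g]
  · simp
  · intro h hh
    rw [lp.single_apply_ne, mul_zero]
    rwa [ne_eq, inv_mul_eq_one]

theorem L1.norm_mul_apply_le (a b : L1 G) (ε : ℝ) (hb : ∀ g, ‖b g‖ ≤ ε) (g : G) :
    ‖(a * b) g‖ ≤ ‖a‖ * ε := by
  rw [L1.mul_apply, L1.norm_eq, ← tsum_mul_right]
  refine (norm_tsum_le_tsum_norm (L1.summable_fiber a b g)).trans
    ((L1.summable_fiber a b g).tsum_le_tsum (fun h => ?_) (a.summable_norm.mul_right ε))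
  rw [norm_mul]
  exact mul_le_mul_of_nonneg_left (hb _) (norm_nonneg _)

end Pairing

/-! ### Sparse subsets of groups -/

section Sparse

variable {G : Type u} [Group G]

/-- A sequence no term of which is of the form `x y⁻¹ z` for earlier terms `x, y, z`. -/
def SparseSeq (e : ℕ → G) : Prop :=
  ∀ n, ∀ i < n, ∀ j < n, ∀ k < n, e n ≠ e i * (e j)⁻¹ * e k

open scoped Pointwise in
theorem exists_sparseSeq [Infinite G] : ∃ e : ℕ → G, SparseSeq e := by
  classical
  choose pick hpick using fun S : Finset G => Infinite.exists_notMem_finset (S * S⁻¹ * S)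
  let S : ℕ → Finset G := fun n => Nat.rec ∅ (fun _ T => insert (pick T) T) n
  have hS : ∀ n, S (n + 1) = insert (pick (S n)) (S n) := fun n => rfl
  have hmono : Monotone S := monotone_nat_of_le_succ fun n => by
    rw [hS]; exact Finset.subset_insert _ _
  have hmem : ∀ i n, i < n → pick (S i) ∈ S n := fun i n hin =>
    hmono (Nat.succ_le_of_lt hin) (by rw [Nat.succ_eq_add_one, hS]; exact Finset.mem_insert_self _ _)
  refine ⟨fun n => pick (S n), fun n i hi j hj k hk h => hpick (S n) ?_⟩
  refine Eq.mpr (congrArg (· ∈ S n * (S n)⁻¹ * S n) h) ?_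
  exact Finset.mul_mem_mul (Finset.mul_mem_mul (hmem i n hi) (Finset.inv_mem_inv (hmem j n hj)))
    (hmem k n hk)

theorem SparseSeq.injective {e : ℕ → G} (he : SparseSeq e) : Function.Injective e := by
  have aux : ∀ m n, m < n → e n ≠ e m := fun m n hmn => by
    simpa using he n m hmn m hmn m hmn
  intro m n h
  rcases lt_trichotomy m n with hmn | hmn | hmn
  · exact absurd h.symm (aux m n hmn)
  · exact hmn
  · exact absurd h (aux n m hmn)

theorem SparseSeq.eq_of_lt {e : ℕ → G} (he : SparseSeq e) {i j k l : ℕ} (hij : i < j)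
    (hkl : k < l)   (h : (e i)⁻¹ * e j = (e k)⁻¹ * e l) : i = k := by
  have aux : ∀ {i j k l : ℕ}, i < j → k < l → (e i)⁻¹ * e j = (e k)⁻¹ * e l → ¬ j < l := by
    intro i j k l hij hkl h hjl
    refine he l k hkl i (hij.trans hjl) j hjl ?_
    rw [mul_assoc, h, mul_inv_cancel_left]
  have hjl : j = l := le_antisymm (not_lt.1 (aux hkl hij h.symm)) (not_lt.1 (aux hij hkl h))
  subst hjl
  exact he.injective (inv_injective (mul_right_cancel h))

/-- Two distinct translates of a sparse sequence have at most two common elements. -/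
theorem SparseSeq.tsum_le {e : ℕ → G} (he : SparseSeq e) (β : G → ℝ≥0∞) (ε : ℝ≥0∞)
    (hβ : ∀ g, β g ≤ ε) {k k' : G} (hk : k ≠ k') :
    ∑' h, β h * ((Set.range e).indicator 1 (h * k) * (Set.range e).indicator 1 (h * k')) ≤
      2 * ε := by
  have single : ∀ S : Set G, S.Subsingleton → ∑' h, S.indicator (fun _ => ε) h ≤ ε := by
    intro S hS
    rcases hS.eq_empty_or_singleton with rfl | ⟨x, rfl⟩
    · simp
    · rw [tsum_eq_single x fun y hy => by simp [hy]]
      simp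
  let S : Set G := {h | ∃ i j, i < j ∧ e i = h * k ∧ e j = h * k'}
  let S' : Set G := {h | ∃ i j, i < j ∧ e i = h * k' ∧ e j = h * k}
  have sub : ∀ (k k' h h' : G) (i j m l : ℕ), i < j → m < l → e i = h * k → e j = h * k' →
      e m = h' * k → e l = h' * k' → h = h' := by
    intro k k' h h' i j m l hij hml hi hj hm hl
    have := he.eq_of_lt hij hml (by rw [hi, hj, hm, hl]; group)
    subst this
    exact mul_right_cancel (hi.symm.trans hm)
  have hS : S.Subsingleton := by
    rintro h ⟨i, j, hij, hi, hj⟩ h' ⟨m, l, hml, hm, hl⟩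
    exact sub k k' h h' i j m l hij hml hi hj hm hl
  have hS' : S'.Subsingleton := by
    rintro h ⟨i, j, hij, hi, hj⟩ h' ⟨m, l, hml, hm, hl⟩
    exact sub k' k h h' i j m l hij hml hi hj hm hl
  calc ∑' h, β h * ((Set.range e).indicator 1 (h * k) * (Set.range e).indicator 1 (h * k'))
      ≤ ∑' h, (S.indicator (fun _ => ε) h + S'.indicator (fun _ => ε) h) := by
        refine ENNReal.tsum_le_tsum fun h => ?_
        by_cases h1 : h * k ∈ Set.range e
        · by_cases h2 : h * k' ∈ Set.range e
          · rw [Set.indicator_of_mem h1, Set.indicator_of_mem h2]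
            obtain ⟨i, hi⟩ := h1
            obtain ⟨j, hj⟩ := h2
            have hβh : β h * (1 * 1) ≤ ε := by simpa using hβ h
            rcases lt_trichotomy i j with hij | hij | hij
            · have : h ∈ S := ⟨i, j, hij, hi, hj⟩
              rw [Set.indicator_of_mem this]
              exact hβh.trans le_self_add
            · subst hij
              exact absurd (mul_left_cancel (hi.symm.trans hj)) hk
            · have : h ∈ S' := ⟨j, i, hij, hj, hi⟩
              rw [Set.indicator_of_mem this]
              exact hβh.trans le_add_self
          · simp [Set.indicator_of_notMem h2]
        · simp [Set.indicator_of_notMem h1]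
    _ ≤ ε + ε := by
        rw [ENNReal.tsum_add]
        exact add_le_add (single S hS) (single S' hS')
    _ = 2 * ε := (two_mul ε).symm

theorem SparseSeq.tsum_sq_le {e : ℕ → G} (he : SparseSeq e) (β γ : G → ℝ≥0∞) (ε C : ℝ≥0∞)
    (hβ : ∀ g, β g ≤ ε) (hγ : ∀ g, γ g ≤ ε) (hβC : ∑' g, β g ≤ C) (hγC : ∑' g, γ g ≤ C) :
    ∑' h, β h * (∑' k, γ k * (Set.range e).indicator 1 (h * k)) ^ 2 ≤ 3 * ε * C ^ 2 := by
  classical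
  set χ : G → ℝ≥0∞ := (Set.range e).indicator 1 with hχ
  have hχ1 : ∀ g, χ g ≤ 1 := fun g => Set.indicator_le_self' (fun _ _ => zero_le) g
  have key : ∀ k k', ∑' h, β h * (χ (h * k) * χ (h * k')) ≤
      2 * ε + if k' = k then C else 0 := by
    intro k k'
    by_cases hk : k' = k
    · rw [if_pos hk]
      refine le_trans (ENNReal.tsum_le_tsum fun h => ?_) (hβC.trans le_add_self)
      calc β h * (χ (h * k) * χ (h * k')) ≤ β h * (1 * 1) := by gcongr <;> exact hχ1 _
        _ = β h := by simp
    · rw [if_neg hk, add_zero]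
      exact he.tsum_le β ε hβ (Ne.symm hk)
  calc ∑' h, β h * (∑' k, γ k * χ (h * k)) ^ 2
      = ∑' h, ∑' k, ∑' k', γ k * (γ k' * (β h * (χ (h * k) * χ (h * k')))) := by
        refine tsum_congr fun h => ?_
        rw [sq, ← ENNReal.tsum_mul_right, ← ENNReal.tsum_mul_left]
        refine tsum_congr fun k => ?_
        rw [← ENNReal.tsum_mul_left, ← ENNReal.tsum_mul_left]
        exact tsum_congr fun k' => by ring
    _ = ∑' k, ∑' k', ∑' h, γ k * (γ k' * (β h * (χ (h * k) * χ (h * k')))) := by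
        rw [ENNReal.tsum_comm]
        exact tsum_congr fun k => ENNReal.tsum_comm
    _ = ∑' k, γ k * ∑' k', γ k' * ∑' h, β h * (χ (h * k) * χ (h * k')) := by
        simp only [ENNReal.tsum_mul_left]
    _ ≤ ∑' k, γ k * ∑' k', γ k' * (2 * ε + if k' = k then C else 0) := by
        gcongr with k k'
        exact key k k'
    _ ≤ ∑' k, γ k * (3 * ε * C) := by
        gcongr with k
        simp only [mul_add, ENNReal.tsum_add, ENNReal.tsum_mul_right]
        have hsingle : ∑' k', γ k' * (if k' = k then C else 0) = γ k * C := by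
          rw [tsum_eq_single k fun k' hk' => by rw [if_neg hk', mul_zero], if_pos rfl]
        rw [hsingle]
        calc (∑' g, γ g) * (2 * ε) + γ k * C ≤ C * (2 * ε) + ε * C := by
              gcongr
              exact hγ k
          _ = 3 * ε * C := by ring
    _ ≤ 3 * ε * C ^ 2 := by
        rw [ENNReal.tsum_mul_right]
        calc (∑' g, γ g) * (3 * ε * C) ≤ C * (3 * ε * C) := by gcongr
          _ = 3 * ε * C ^ 2 := by ring

theorem SparseSeq.tsum_mul_le {e : ℕ → G} (he : SparseSeq e) (β γ : G → ℝ≥0∞) (ε C η : ℝ≥0∞)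
    (hη : η ≠ 0) (hη' : η ≠ ∞)
    (hβ : ∀ g, β g ≤ ε) (hγ : ∀ g, γ g ≤ ε) (hβC : ∑' g, β g ≤ C) (hγC : ∑' g, γ g ≤ C) :
    ∑' h, β h * ∑' k, γ k * (Set.range e).indicator 1 (h * k) ≤
      η * C + η⁻¹ * (3 * ε * C ^ 2) := by
  have aux : ∀ F : ℝ≥0∞, F ≤ η + η⁻¹ * F ^ 2 := by
    intro F
    rcases le_total F η with hF | hF
    · exact hF.trans le_self_add
    · refine le_trans ?_ le_add_self
      calc F = η⁻¹ * (η * F) := by rw [← mul_assoc, ENNReal.inv_mul_cancel hη hη', one_mul]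
        _ ≤ η⁻¹ * (F * F) := by gcongr
        _ = η⁻¹ * F ^ 2 := by rw [sq]
  calc ∑' h, β h * ∑' k, γ k * (Set.range e).indicator 1 (h * k)
      ≤ ∑' h, (η * β h +
          η⁻¹ * (β h * (∑' k, γ k * (Set.range e).indicator 1 (h * k)) ^ 2)) := by
        refine ENNReal.tsum_le_tsum fun h => (mul_le_mul_right (aux _) (β h)).trans (le_of_eq ?_)
        ring
    _ ≤ η * C + η⁻¹ * (3 * ε * C ^ 2) := by
        rw [ENNReal.tsum_add, ENNReal.tsum_mul_left, ENNReal.tsum_mul_left]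
        gcongr
        exact he.tsum_sq_le β γ ε C hβ hγ hβC hγC

theorem SparseSeq.norm_pairing_mul_le {e : ℕ → G} (he : SparseSeq e) (a b : L1 G)
    {ε C η : ℝ} (hε : 0 ≤ ε) (hC : 0 ≤ C) (hη : 0 < η) (ha : ∀ g, ‖a g‖ ≤ ε)
    (hb : ∀ g, ‖b g‖ ≤ ε) (haC : ‖a‖ ≤ C) (hbC : ‖b‖ ≤ C) :
    ‖L1.pairing ((Set.range e).indicator 1) (norm_indicator_one_le _) (a * b)‖ ≤
      η * C + η⁻¹ * (3 * ε * C ^ 2) := by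
  have hpos : 0 ≤ η * C + η⁻¹ * (3 * ε * C ^ 2) := by positivity
  rw [← ENNReal.ofReal_le_ofReal_iff hpos, ofReal_norm]
  have bound : ∀ (x : L1 G) g, ‖x g‖ ≤ ε → ‖x g‖ₑ ≤ ENNReal.ofReal ε := fun x g hx => by
    rw [← ofReal_norm]; exact ENNReal.ofReal_le_ofReal hx
  have total : ∀ x : L1 G, ‖x‖ ≤ C → ∑' g, ‖x g‖ₑ ≤ ENNReal.ofReal C := fun x hx => by
    rw [← L1.enorm_eq, ← ofReal_norm]; exact ENNReal.ofReal_le_ofReal hx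
  have main := he.tsum_mul_le (fun g => ‖a g‖ₑ) (fun g => ‖b g‖ₑ) (ENNReal.ofReal ε)
    (ENNReal.ofReal C) (ENNReal.ofReal η) (by simpa using hη) ENNReal.ofReal_ne_top
    (fun g => bound a g (ha g)) (fun g => bound b g (hb g)) (total a haC) (total b hbC)
  have h1 : ENNReal.ofReal (η * C + η⁻¹ * (3 * ε * C ^ 2)) =
      ENNReal.ofReal η * ENNReal.ofReal C + (ENNReal.ofReal η)⁻¹ *
        (3 * ENNReal.ofReal ε * ENNReal.ofReal C ^ 2) := by
    rw [ENNReal.ofReal_add (by positivity) (by positivity), ENNReal.ofReal_mul hη.le,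
      ENNReal.ofReal_mul (by positivity), ENNReal.ofReal_inv_of_pos hη,
      ENNReal.ofReal_mul (by positivity), ENNReal.ofReal_mul (by positivity),
      ENNReal.ofReal_pow hC]
    norm_num
  rw [h1]
  refine le_trans ?_ main
  calc ‖L1.pairing ((Set.range e).indicator 1) (norm_indicator_one_le _) (a * b)‖ₑ
      ≤ ∑' g, ‖(Set.range e).indicator (1 : G → ℂ) g * (a * b) g‖ₑ := enorm_tsum_le_tsum_enorm
    _ ≤ ∑' g, ∑' h, ‖a h‖ₑ * (‖b (h⁻¹ * g)‖ₑ * (Set.range e).indicator 1 g) := by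
        refine ENNReal.tsum_le_tsum fun g => ?_
        by_cases hg : g ∈ Set.range e
        · rw [Set.indicator_of_mem hg, Set.indicator_of_mem hg]
          simp only [Pi.one_apply, one_mul, mul_one]
          refine enorm_tsum_le_tsum_enorm.trans (le_of_eq (tsum_congr fun h => enorm_mul _ _))
        · simp [Set.indicator_of_notMem hg]
    _ = ∑' h, ∑' g, ‖a h‖ₑ * (‖b (h⁻¹ * g)‖ₑ * (Set.range e).indicator 1 g) :=
        ENNReal.tsum_comm
    _ = ∑' h, ‖a h‖ₑ * ∑' k, ‖b k‖ₑ * (Set.range e).indicator 1 (h * k) := by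
        refine tsum_congr fun h => ?_
        rw [ENNReal.tsum_mul_left, ← (Equiv.mulLeft h).tsum_eq
          (fun g => ‖b (h⁻¹ * g)‖ₑ * (Set.range e).indicator 1 g)]
        simp

end Sparse

/-! ### Atomic and diffuse parts of ultrapowers of `ℓ¹(G)` -/

/-- The bounded family with the given terms. -/
def boundedFamily {I : Type v} {E : Type u} [NormedAddCommGroup E] (f : I → E) (C : ℝ)
    (hf : ∀ i, ‖f i‖ ≤ C) : lp (fun _ : I => E) ∞ :=
  ⟨f, memℓp_infty ⟨C, by rintro _ ⟨i, rfl⟩; exact hf i⟩⟩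

section Atoms

variable {I : Type v} (U : Ultrafilter I) {G : Type u}

/-- A family of elements of `G` representing an element of the ultrapower of `G`. -/
def germRep (γ : (U : Filter I).Germ G) : I → G :=
  Quotient.out (s := (U : Filter I).germSetoid G) γ

variable {U} in
theorem coe_germRep (γ : (U : Filter I).Germ G) :
    ((germRep U γ : I → G) : (U : Filter I).Germ G) = γ :=
  Quotient.out_eq (s := (U : Filter I).germSetoid G) γ

theorem germRep_coe (g : I → G) : germRep U (g : (U : Filter I).Germ G) =ᶠ[U] g :=
  Filter.Germ.coe_eq.1 (coe_germRep _)

theorem eventually_germRep_ne {γ γ' : (U : Filter I).Germ G} (h : γ ≠ γ') :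
    ∀ᶠ i in U, germRep U γ i ≠ germRep U γ' i := by
  refine Ultrafilter.eventually_not.2 fun h' => h ?_
  rw [← coe_germRep γ, ← coe_germRep γ']
  exact Filter.Germ.coe_eq.2 h'

/-- The coefficient of an element of the ultrapower of `ℓ¹(G)` at an element of the ultrapower
of `G`. -/
def atomCoeff (γ : (U : Filter I).Germ G) : StrongDual ℂ (Ultrapower U (L1 G)) :=
  ultraFunctional U (fun i => L1.eval (germRep U γ i)) fun _ y => L1.norm_eval_le _ y

theorem tendsto_atomCoeff (γ : (U : Filter I).Germ G) (x : lp (fun _ : I => L1 G) ∞) :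
    Filter.Tendsto (fun i => x i (germRep U γ i)) U
      (𝓝 (atomCoeff U γ (Submodule.Quotient.mk x))) :=
  tendsto_ultraFunctional U (fun i => L1.eval (germRep U γ i)) (fun _ y => L1.norm_eval_le _ y) x

theorem sum_norm_atomCoeff_le (s : Finset ((U : Filter I).Germ G)) (b : Ultrapower U (L1 G)) :
    ∑ γ ∈ s, ‖atomCoeff U γ b‖ ≤ ‖b‖ := by
  classical
  refine le_of_forall_pos_le_add fun ε hε => ?_
  obtain ⟨x, rfl, hx⟩ := Submodule.Quotient.norm_mk_lt b hε
  refine le_trans ?_ hx.le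
  refine le_of_tendsto (tendsto_finsetSum s fun γ _ => (tendsto_atomCoeff U γ x).norm) ?_
  have hinj : ∀ᶠ i in U, ∀ γ ∈ s, ∀ γ' ∈ s, γ ≠ γ' → germRep U γ i ≠ germRep U γ' i := by
    refine (Filter.eventually_all_finset s).2 fun γ _ =>
      (Filter.eventually_all_finset s).2 fun γ' _ => ?_
    by_cases h : γ = γ'
    · exact Filter.Eventually.of_forall fun _ h' => absurd h h'
    · exact (eventually_germRep_ne U h).mono fun _ hi _ => hi
  filter_upwards [hinj] with i hi
  have hio : Set.InjOn (fun γ => germRep U γ i) s := fun γ hγ γ' hγ' h =>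
    by_contra fun hne => hi γ hγ γ' hγ' hne h
  calc ∑ γ ∈ s, ‖x i (germRep U γ i)‖
      = ∑ g ∈ s.image (fun γ => germRep U γ i), ‖x i g‖ :=
        (Finset.sum_image (f := fun g => ‖x i g‖) hio).symm
    _ ≤ ∑' g, ‖x i g‖ := (x i).summable_norm.sum_le_tsum _ fun _ _ => norm_nonneg _
    _ = ‖x i‖ := (L1.norm_eq _).symm
    _ ≤ ‖x‖ := lp.norm_apply_le_norm ENNReal.top_ne_zero x i

theorem summable_norm_atomCoeff (b : Ultrapower U (L1 G)) :
    Summable fun γ => ‖atomCoeff U γ b‖ :=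
  summable_of_sum_le (fun _ => norm_nonneg _) fun s => sum_norm_atomCoeff_le U s b

open Classical in
/-- The class of the family of point masses at the terms of a family in `G`. -/
def atom (γ : (U : Filter I).Germ G) : Ultrapower U (L1 G) :=
  Submodule.Quotient.mk (boundedFamily (fun i => (lp.single 1 (germRep U γ i) (1 : ℂ) : L1 G)) 1
    fun i => by rw [lp.norm_single one_pos]; simp)

theorem norm_atom_le (γ : (U : Filter I).Germ G) : ‖atom U γ‖ ≤ 1 := by
  classical
  refine (Submodule.Quotient.norm_mk_le _ _).trans
    (lp.norm_le_of_forall_le zero_le_one fun i => ?_)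
  change ‖(lp.single 1 (germRep U γ i) (1 : ℂ) : L1 G)‖ ≤ 1
  rw [lp.norm_single one_pos]
  simp

theorem atomCoeff_atom_self (γ : (U : Filter I).Germ G) : atomCoeff U γ (atom U γ) = 1 := by
  classical
  refine tendsto_nhds_unique (tendsto_atomCoeff U γ _) (tendsto_const_nhds.congr fun i => ?_)
  exact (lp.single_apply_self (E := fun _ : G => ℂ) 1 (germRep U γ i) (1 : ℂ)).symm

theorem atomCoeff_atom_of_ne {γ γ' : (U : Filter I).Germ G} (h : γ' ≠ γ) :
    atomCoeff U γ (atom U γ') = 0 := by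
  classical
  refine tendsto_nhds_unique (tendsto_atomCoeff U γ _) (tendsto_const_nhds.congr' ?_)
  filter_upwards [eventually_germRep_ne U h.symm] with i hi
  exact (lp.single_apply_ne (E := fun _ : G => ℂ) 1 (germRep U γ' i) (1 : ℂ) hi).symm

theorem norm_atomCoeff_smul_le (b : Ultrapower U (L1 G)) (γ : (U : Filter I).Germ G) :
    ‖atomCoeff U γ b • atom U γ‖ ≤ ‖atomCoeff U γ b‖ := by
  rw [norm_smul]
  exact mul_le_of_le_one_right (norm_nonneg _) (norm_atom_le U γ)

theorem summable_norm_atoms (b : Ultrapower U (L1 G)) :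
    Summable fun γ => ‖atomCoeff U γ b • atom U γ‖ :=
  Summable.of_nonneg_of_le (fun _ => norm_nonneg _) (norm_atomCoeff_smul_le U b)
    (summable_norm_atomCoeff U b)

theorem summable_atoms (b : Ultrapower U (L1 G)) :
    Summable fun γ => atomCoeff U γ b • atom U γ :=
  (summable_norm_atoms U b).of_norm

/-- The atomic part of an element of the ultrapower of `ℓ¹(G)`. -/
def atomicPart : Ultrapower U (L1 G) →L[ℂ] Ultrapower U (L1 G) :=
  LinearMap.mkContinuous
    { toFun := fun b => ∑' γ, atomCoeff U γ b • atom U γ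
      map_add' := fun a b => by
        rw [← (summable_atoms U a).tsum_add (summable_atoms U b)]
        exact tsum_congr fun γ => by rw [map_add, add_smul]
      map_smul' := fun c b => by
        rw [RingHom.id_apply, ← (summable_atoms U b).tsum_const_smul c]
        exact tsum_congr fun γ => by rw [map_smul, smul_assoc] } 1 (fun b => by
      rw [one_mul]
      refine (norm_tsum_le_tsum_norm (summable_norm_atoms U b)).trans
        ((summable_norm_atoms U b).tsum_le_of_sum_le fun s => ?_)
      exact (Finset.sum_le_sum fun γ _ => norm_atomCoeff_smul_le U b γ).trans
        (sum_norm_atomCoeff_le U s b))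

theorem atomicPart_apply (b : Ultrapower U (L1 G)) :
    atomicPart U b = ∑' γ, atomCoeff U γ b • atom U γ := rfl

theorem atomCoeff_atomicPart (γ : (U : Filter I).Germ G) (b : Ultrapower U (L1 G)) :
    atomCoeff U γ (atomicPart U b) = atomCoeff U γ b := by
  rw [atomicPart_apply, (atomCoeff U γ).map_tsum (summable_atoms U b), tsum_eq_single γ]
  · rw [map_smul, atomCoeff_atom_self, smul_eq_mul, mul_one]
  · intro γ' h
    rw [map_smul, atomCoeff_atom_of_ne U h, smul_zero]

variable (G) in
/-- The elements of the ultrapower of `ℓ¹(G)` without atoms. -/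
def diffuse : Submodule ℂ (Ultrapower U (L1 G)) where
  carrier := {b | ∀ γ, atomCoeff U γ b = 0}
  zero_mem' := fun γ => map_zero _
  add_mem' := fun ha hb γ => by rw [map_add, ha γ, hb γ, add_zero]
  smul_mem' := fun c b hb γ => by rw [map_smul, hb γ, smul_zero]

theorem mk_mem_diffuse_iff (x : lp (fun _ : I => L1 G) ∞) :
    (Submodule.Quotient.mk x : Ultrapower U (L1 G)) ∈ diffuse U G ↔
      ∀ ε : ℝ, 0 < ε → ∀ᶠ i in U, ∀ g, ‖x i g‖ ≤ ε := by
  constructor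
  · intro hx ε hε
    by_contra hcon
    have hex : ∀ᶠ i in U, ∃ g, ε < ‖x i g‖ :=
      (Ultrafilter.eventually_not.2 hcon).mono fun i hi => by simpa using hi
    obtain ⟨i₀, g₀, -⟩ := hex.exists
    classical
    let g : I → G := fun i => if h : ∃ g, ε < ‖x i g‖ then h.choose else g₀
    have hg : ∀ᶠ i in U, ε < ‖x i (g i)‖ := hex.mono fun i hi => by
      simp only [g, dif_pos hi]
      exact hi.choose_spec
    have hlim := (tendsto_atomCoeff U (g : (U : Filter I).Germ G) x).norm
    rw [hx _, norm_zero] at hlim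
    have : ε ≤ 0 := ge_of_tendsto hlim (by
      filter_upwards [hg, germRep_coe U g] with i h1 h2
      rw [h2]
      exact h1.le)
    exact absurd hε this.not_gt
  · intro hx γ
    refine tendsto_nhds_unique (tendsto_atomCoeff U γ x) ?_
    rw [Metric.tendsto_nhds]
    intro ε hε
    filter_upwards [hx (ε / 2) (half_pos hε)] with i hi
    rw [dist_zero_right]
    exact (hi _).trans_lt (half_lt_self hε)

variable [Group G]

theorem mul_mem_diffuse (a b : Ultrapower U (L1 G)) (hb : b ∈ diffuse U G) :
    a * b ∈ diffuse U G := by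
  obtain ⟨x, rfl⟩ := Submodule.Quotient.mk_surjective _ a
  obtain ⟨y, rfl⟩ := Submodule.Quotient.mk_surjective _ b
  rw [mk_mem_diffuse_iff] at hb
  rw [← mk_mul, mk_mem_diffuse_iff]
  intro ε hε
  have hpos : 0 < ‖x‖ + 1 := by positivity
  filter_upwards [hb (ε / (‖x‖ + 1)) (by positivity)] with i hi g
  calc ‖(x i * y i) g‖ ≤ ‖x i‖ * (ε / (‖x‖ + 1)) := L1.norm_mul_apply_le _ _ _ hi g
    _ ≤ (‖x‖ + 1) * (ε / (‖x‖ + 1)) := by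
        gcongr
        exact (lp.norm_apply_le_norm ENNReal.top_ne_zero x i).trans (by linarith)
    _ = ε := mul_div_cancel₀ _ hpos.ne'

/-- Summation over the terms of a sequence, as a functional on the ultrapower of `ℓ¹(G)`. -/
def rangeFunctional (e : ℕ → G) : StrongDual ℂ (Ultrapower U (L1 G)) :=
  ultraFunctional U
    (fun _ => L1.pairing ((Set.range e).indicator 1) (norm_indicator_one_le _))
    fun _ y => L1.norm_pairing_le _ _ y

theorem tendsto_rangeFunctional (e : ℕ → G) (x : lp (fun _ : I => L1 G) ∞) :
    Filter.Tendsto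
      (fun i => L1.pairing ((Set.range e).indicator 1) (norm_indicator_one_le _) (x i)) U
      (𝓝 (rangeFunctional U e (Submodule.Quotient.mk x))) :=
  tendsto_ultraFunctional U _ _ x

theorem SparseSeq.rangeFunctional_mul {e : ℕ → G} (he : SparseSeq e)
    (a b : Ultrapower U (L1 G)) (ha : a ∈ diffuse U G) (hb : b ∈ diffuse U G) :
    rangeFunctional U e (a * b) = 0 := by
  obtain ⟨x, rfl⟩ := Submodule.Quotient.mk_surjective _ a
  obtain ⟨y, rfl⟩ := Submodule.Quotient.mk_surjective _ b
  rw [mk_mem_diffuse_iff] at ha hb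
  rw [← mk_mul]
  refine tendsto_nhds_unique (tendsto_rangeFunctional U e (x * y)) ?_
  rw [Metric.tendsto_nhds]
  intro δ hδ
  set C : ℝ := ‖x‖ + ‖y‖ + 1 with hCdef
  have hC : 0 < C := by positivity
  set η : ℝ := δ / (3 * C) with hη
  have hηpos : 0 < η := by positivity
  set ε : ℝ := η * δ / (9 * C ^ 2) with hε
  have hεpos : 0 < ε := by positivity
  filter_upwards [ha ε hεpos, hb ε hεpos] with i hx hy
  rw [dist_zero_right]
  have hxC : ‖x i‖ ≤ C := (lp.norm_apply_le_norm ENNReal.top_ne_zero x i).trans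
    (by linarith [norm_nonneg y])
  have hyC : ‖y i‖ ≤ C := (lp.norm_apply_le_norm ENNReal.top_ne_zero y i).trans
    (by linarith [norm_nonneg x])
  refine (he.norm_pairing_mul_le (x i) (y i) hεpos.le hC.le hηpos hx hy hxC hyC).trans_lt ?_
  have h1 : η * C = δ / 3 := by rw [hη]; field_simp
  have h2 : η⁻¹ * (3 * ε * C ^ 2) = δ / 3 := by rw [hε]; field_simp; norm_num
  rw [h1, h2]
  linarith

/-- The uniform probability on the first `n + 1` terms of a sequence. -/
def uniformOn [DecidableEq G] (e : ℕ → G) (n : ℕ) : L1 G :=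
  ((n : ℂ) + 1)⁻¹ • ∑ m ∈ Finset.range (n + 1), lp.single 1 (e m) (1 : ℂ)

theorem norm_natCast_add_one_inv (n : ℕ) : ‖((n : ℂ) + 1)⁻¹‖ = ((n : ℝ) + 1)⁻¹ := by
  rw [norm_inv]
  norm_cast

theorem norm_uniformOn_le [DecidableEq G] (e : ℕ → G) (n : ℕ) : ‖uniformOn e n‖ ≤ 1 := by
  have h : ‖∑ m ∈ Finset.range (n + 1), (lp.single 1 (e m) (1 : ℂ) : L1 G)‖ ≤ (n : ℝ) + 1 := by
    refine (norm_sum_le _ _).trans ?_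
    simp [lp.norm_single]
  rw [uniformOn, norm_smul, norm_natCast_add_one_inv]
  calc ((n : ℝ) + 1)⁻¹ * _ ≤ ((n : ℝ) + 1)⁻¹ * ((n : ℝ) + 1) := by gcongr
    _ = 1 := inv_mul_cancel₀ (by positivity)

theorem norm_uniformOn_apply_le [DecidableEq G] {e : ℕ → G} (he : Function.Injective e) (n : ℕ)
    (g : G) : ‖uniformOn e n g‖ ≤ ((n : ℝ) + 1)⁻¹ := by
  have h : ‖(∑ m ∈ Finset.range (n + 1), (lp.single 1 (e m) (1 : ℂ) : L1 G)) g‖ ≤ 1 := by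
    rw [lp.coeFn_sum, Finset.sum_apply]
    by_cases hg : ∃ m, e m = g
    · obtain ⟨m, rfl⟩ := hg
      by_cases hm : m ∈ Finset.range (n + 1)
      · rw [Finset.sum_eq_single_of_mem m hm fun k _ hk =>
          lp.single_apply_ne (E := fun _ : G => ℂ) 1 (e k) 1 fun h => hk (he h).symm]
        simp
      · rw [Finset.sum_eq_zero fun k hk =>
          lp.single_apply_ne (E := fun _ : G => ℂ) 1 (e k) 1 fun h => hm (by rw [he h]; exact hk)]
        simp
    · rw [Finset.sum_eq_zero fun k _ =>
        lp.single_apply_ne (E := fun _ : G => ℂ) 1 (e k) 1 fun h => hg ⟨k, h.symm⟩]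
      simp
  rw [uniformOn, lp.coeFn_smul, Pi.smul_apply, norm_smul, norm_natCast_add_one_inv]
  exact mul_le_of_le_one_right (by positivity) h

theorem pairing_uniformOn [DecidableEq G] (e : ℕ → G) (n : ℕ) :
    L1.pairing ((Set.range e).indicator 1) (norm_indicator_one_le _) (uniformOn e n) = 1 := by
  have h : ∀ m, L1.pairing ((Set.range e).indicator 1) (norm_indicator_one_le _)
      (lp.single 1 (e m) (1 : ℂ)) = 1 := by
    intro m
    rw [L1.pairing_apply, tsum_eq_single (e m)]
    · simp
    · intro g hg
      rw [lp.single_apply_ne _ _ _ hg, mul_zero]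
  rw [uniformOn, map_smul, map_sum]
  simp only [h, Finset.sum_const, Finset.card_range, nsmul_eq_mul, mul_one, smul_eq_mul]
  push_cast
  exact inv_mul_cancel₀ (Nat.cast_add_one_ne_zero n)

theorem CountablyIncomplete.exists_tendsto_atTop {U : Ultrafilter I}
    (hU : CountablyIncomplete U) : ∃ n : I → ℕ, Filter.Tendsto n U Filter.atTop := by
  classical
  obtain ⟨s, hs, hsU, hempty⟩ := hU
  have hex : ∀ i, ∃ n, i ∉ s n := fun i => by
    by_contra hcon
    have : i ∈ ⋂ n, s n := Set.mem_iInter.2 fun n => by_contra fun h => hcon ⟨n, h⟩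
    rw [hempty] at this
    exact this
  refine ⟨fun i => Nat.find (hex i), Filter.tendsto_atTop.2 fun N => ?_⟩
  filter_upwards [hsU N] with i hi
  by_contra hlt
  exact Nat.find_spec (hex i) (hs (not_le.1 hlt).le hi)

theorem not_amenable_ultrapower [Infinite G] {U : Ultrafilter I} (hU : CountablyIncomplete U) :
    ¬ Amenable (Ultrapower U (L1 G)) := by
  classical
  intro hA
  obtain ⟨e, he⟩ := exists_sparseSeq (G := G)
  obtain ⟨n, hn⟩ := hU.exists_tendsto_atTop
  let unit : Ultrapower U (L1 G) := Submodule.Quotient.mk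
    (boundedFamily (fun _ => (lp.single 1 (1 : G) (1 : ℂ) : L1 G)) 1
      fun i => by rw [lp.norm_single one_pos]; simp)
  have hunit : ∀ b, b * unit = b := by
    intro b
    obtain ⟨x, rfl⟩ := Submodule.Quotient.mk_surjective _ b
    refine congrArg Submodule.Quotient.mk (Subtype.ext (funext fun i => ?_))
    exact L1.mul_single_one (x i)
  let y : lp (fun _ : I => L1 G) ∞ :=
    boundedFamily (fun i => uniformOn e (n i)) 1 fun i => norm_uniformOn_le e (n i)
  have hy : (Submodule.Quotient.mk y : Ultrapower U (L1 G)) ∈ diffuse U G := by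
    rw [mk_mem_diffuse_iff]
    intro ε hε
    have hlim := (tendsto_one_div_add_atTop_nhds_zero_nat (𝕜 := ℝ)).comp hn
    filter_upwards [hlim.eventually (gt_mem_nhds hε)] with i hi g
    refine (norm_uniformOn_apply_le he.injective (n i) g).trans ?_
    rw [← one_div]
    exact hi.le
  have hzero := hA.eq_zero_of_mul_eq_zero unit hunit (diffuse U G)
    (fun a b hb => mul_mem_diffuse U a b hb) (ContinuousLinearMap.id ℂ _ - atomicPart U)
    (fun b γ => by
      change atomCoeff U γ (b - atomicPart U b) = 0
      rw [map_sub, atomCoeff_atomicPart, sub_self])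
    (fun b hb => by
      change b - atomicPart U b = b
      rw [atomicPart_apply]
      simp [hb _])
    (rangeFunctional U e) (fun a ha b hb => he.rangeFunctional_mul U a b ha hb) _ hy
  have hone : rangeFunctional U e (Submodule.Quotient.mk y) = 1 :=
    tendsto_nhds_unique (tendsto_rangeFunctional U e y)
      (tendsto_const_nhds.congr fun i => (pairing_uniformOn e (n i)).symm)
  exact zero_ne_one (hzero.symm.trans hone)

end Atoms

theorem CountablyIncomplete.nonPrincipal {I : Type v} {U : Ultrafilter I}
    (hU : CountablyIncomplete U) : NonPrincipal U := by
  rintro i rfl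
  obtain ⟨s, -, hs, hempty⟩ := hU
  have : i ∈ ⋂ n, s n := Set.mem_iInter.2 fun n => Ultrafilter.mem_pure.1 (hs n)
  rw [hempty] at this
  exact this

theorem exists_countablyIncomplete :
    ∃ U : Ultrafilter (ULift.{v} ℕ), CountablyIncomplete U := by
  refine ⟨Filter.hyperfilter _, fun n => {i | n ≤ i.down}, fun m n hmn i hi => hmn.trans hi,
    fun n => ?_, ?_⟩
  · refine Filter.mem_hyperfilter_of_finite_compl ?_
    refine ((Set.finite_lt_nat n).preimage ULift.down_injective.injOn).subset fun i hi => ?_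
    have hi' : ¬ n ≤ i.down := hi
    exact not_le.1 hi'
  · refine Set.eq_empty_of_forall_notMem fun i hi => ?_
    exact Nat.not_succ_le_self i.down (Set.mem_iInter.1 hi (i.down + 1))

end BanachUltra

end

theorem mainTheorem3 (G : Type u) [Group G] [Infinite G] :
    (∀ (I : Type v) (U : Ultrafilter I), BanachUltra.CountablyIncomplete U →
      ¬ BanachUltra.Amenable (BanachUltra.Ultrapower U (BanachUltra.L1 G))) ∧
    ¬ BanachUltra.UltraAmenable.{u, v} (BanachUltra.L1 G) := by
  refine ⟨fun I U hU => BanachUltra.not_amenable_ultrapower hU, fun h => ?_⟩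
  obtain ⟨U, hU⟩ := BanachUltra.exists_countablyIncomplete.{v}
  exact BanachUltra.not_amenable_ultrapower hU (h _ U hU.nonPrincipal)
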